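/- Setting. Let $\Pi$ be a finite nonempty decision space (every subset measurable), $\mathcal R=[0,1]$ the reward space with its Borel $\sigma$-algebra $\mathscr R$, and $(\mathcal O,\mathscr O)$ an arbitrary measurable observation space. A model is a probability kernel $M:\pi\mapsto M(\pi)=M(\cdot\mid\pi)$ from $\Pi$ to $\mathcal R\times\mathcal O$, and $\mathcal M$ is a nonempty class of models. For a model $M$ put $f^M(\pi)=\mathbb E_{(r,o)\sim M(\pi)}[r]$ and $\pi_M\in\arg\max_{\pi\in\Pi}f^M(\pi)$. For $\varepsilon\ge 0$ and $\overline M\in\mathcal M$ let $\mathcal M_\varepsilon(\overline M)=\{M\in\mathcal M: f^{\overline M}(\pi_{\overline M})\ge f^M(\pi_M)-\varepsilon\}$. For $\gamma>0$ and a class of models $\mathcal M'$, the Decision-Estimation Coefficient is $$\mathsf{dec}_\gamma(\mathcal M',\overline M)=\inf_{p\in\Delta(\Pi)}\ \sup_{M\in\mathcal M'}\ \mathbb E_{\pi\sim p}\big[f^M(\pi_M)-f^M(\pi)-\gamma\, D_{\mathsf H}^2(M(\pi),\overline M(\pi))\big],$$ where $\Delta(\Pi)$ is the set of probability measures on $\Pi$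 and $D_{\mathsf H}^2(P,Q)=\int\big(\sqrt{dP/d\nu}-\sqrt{dQ/d\nu}\big)^2d\nu$ (for any $\nu$ dominating $P$ and $Q$) is the squared Hellinger distance. Let $$V(\mathcal M)=\max\Big\{e,\ \sup_{M,M'\in\mathcal M}\ \sup_{\pi\in\Pi}\ \sup_{A\in\mathscr R\otimes\mathscr O}\frac{M(A\mid\pi)}{M'(A\mid\pi)}\Big\}\in[e,\infty],$$ with $0/0=0$ and $a/0=\infty$ for $a>0$. An algorithm for horizon $T$ is a sequence $p^{(1)},\dots,p^{(T)}$ in which $p^{(t)}$ is a probability kernel from $(\Pi\times\mathcal R\times\mathcal O)^{t-1}$ to $\Pi$. Given a model $M$, in each round $t=1,\dots,T$ a decision $\pi^{(t)}\sim p^{(t)}(\cdot\mid\mathcal H^{(t-1)})$ and then $(r^{(t)},o^{(t)})\sim M(\pi^{(t)})$ are drawn, where $\mathcal H^{(t)}=((\pi^{(s)},r^{(s)},o^{(s)}))_{s\le t}$. Let $\mathbb E^M$ denote expectation under the resulting law of $\mathcal H^{(T)}$, and let $$\mathrm{Reg}=\sum_{t=1}^T\mathbb E_{\pi\sim p^{(t)}(\cdot\mid\mathcal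 H^{(t-1)})}\big[f^M(\pi_M)-f^M(\pi)\big],\qquad \mathbb V_+^M[\mathrm{Reg}]=\mathbb E^M\big[(\mathrm{Reg}-\mathbb E^M[\mathrm{Reg}])_+^2\big],$$ where $(x)_+=\max\{x,0\}$. Theorem. Let $T\ge 2$, $C(T)=2^9\log(T\wedge V(\mathcal M))$ and $\varepsilon_\gamma=\frac{\gamma}{4C(T)T}$. For every algorithm for horizon $T$ there exists a model $M\in\mathcal M$ such that $$\mathbb E^M[\mathrm{Reg}]+\sqrt{\mathbb V_+^M[\mathrm{Reg}]}\ \ge\ \frac18\cdot\sup_{\gamma\ge 4\sqrt{C(T)T}}\ \sup_{\overline M\in\mathcal M}\mathsf{dec}_\gamma\big(\mathcal M_{\varepsilon_\gamma}(\overline M),\overline M\big)\cdot T.$$ -/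

import Mathlib

open MeasureTheory ProbabilityTheory
open scoped ENNReal

noncomputable section

namespace DMSO

/-- A model: a probability kernel from decisions to pairs (reward, observation), with rewards
in `[0, 1]`. -/
structure Model (Act Obs : Type*) [MeasurableSpace Act] [MeasurableSpace Obs] where
  /-- the underlying kernel `π ↦ M(π)` -/
  kernel : Kernel Act (unitInterval × Obs)
  /-- every `M(π)` is a probability measure -/
  isMarkov : IsMarkovKernel kernel

attribute [instance] Model.isMarkov

/-- One round of interaction: decision, reward, observation. -/
abbrev Round (Act Obs : Type*) : Type _ := Act × (unitInterval × Obs)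

/-- An algorithm for horizon `T`: for each round (indexed by `t = 0, …, T - 1`) a probability
kernel from the history of the `t` previous rounds to the decision space. -/
structure Algorithm (Act Obs : Type*) [MeasurableSpace Act] [MeasurableSpace Obs] (T : ℕ) where
  /-- the sampling distribution of a round, given the history before it -/
  kernel : (t : Fin T) → Kernel (Fin t → Round Act Obs) Act
  /-- the sampling distributions are probability measures -/
  isMarkov : ∀ t, IsMarkovKernel (kernel t)

attribute [instance] Algorithm.isMarkov

/-- The squared Hellinger distance `∫ (√(dP/dν) - √(dQ/dν))² dν`, with the dominating measure
`ν = P + Q`. -/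
def hellingerSq {X : Type*} [MeasurableSpace X] (P Q : Measure X) : ℝ :=
  ∫ x, (√(P.rnDeriv (P + Q) x).toReal - √(Q.rnDeriv (P + Q) x).toReal) ^ 2 ∂(P + Q)

/-- The one-sided variance `E[(Z - E[Z])₊²]` of `Z` under `P`. -/
def oneSidedVariance {X : Type*} [MeasurableSpace X] (P : Measure X) (Z : X → ℝ) : ℝ :=
  ∫ x, (max (Z x - ∫ y, Z y ∂P) 0) ^ 2 ∂P

section

variable {Act Obs : Type*} [MeasurableSpace Act] [MeasurableSpace Obs]

/-- The mean reward function `f^M(π)`. -/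
def Model.meanReward (M : Model Act Obs) (π : Act) : ℝ :=
  ∫ z, (z.1 : ℝ) ∂(M.kernel π)

/-- A decision `π_M` of greatest mean reward. -/
def Model.bestDecision [Finite Act] [Nonempty Act] (M : Model Act Obs) : Act :=
  (Finite.exists_max M.meanReward).choose

theorem Model.meanReward_le_bestDecision [Finite Act] [Nonempty Act] (M : Model Act Obs)
    (π : Act) : M.meanReward π ≤ M.meanReward M.bestDecision :=
  (Finite.exists_max M.meanReward).choose_spec π

/-- The law of the history of the first `t ≤ T` rounds when the algorithm interacts with the fixed
model `M`: given the past, the decision is drawn from the algorithm's kernel and then the pair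
(reward, observation) from `M` at that decision. -/
def historyLaw {T : ℕ} (alg : Algorithm Act Obs T) (M : Model Act Obs) :
    (t : ℕ) → t ≤ T → Measure (Fin t → Round Act Obs)
  | 0, _ => Measure.dirac Fin.elim0
  | t + 1, h =>
      (historyLaw alg M t (Nat.le_of_succ_le h) ⊗ₘ
          (alg.kernel ⟨t, h⟩ ⊗ₖ M.kernel.prodMkLeft (Fin t → Round Act Obs))).map
        (fun x => (Fin.snoc x.1 x.2 : Fin (t + 1) → Round Act Obs))

/-- The law `P^M` of the full history of `T` rounds. -/
def fullLaw {T : ℕ} (alg : Algorithm Act Obs T) (M : Model Act Obs) :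
    Measure (Fin T → Round Act Obs) :=
  historyLaw alg M T le_rfl

/-- Regret in the stochastic setting with underlying model `M`, as a function of the history:
the sum over rounds of `E_{π ∼ p_t}[f^M(π_M) - f^M(π)]`, where `p_t` is the algorithm's
distribution given the rounds before `t`. -/
def regret [Finite Act] [Nonempty Act] {T : ℕ} (alg : Algorithm Act Obs T) (M : Model Act Obs)
    (H : Fin T → Round Act Obs) : ℝ :=
  ∑ t : Fin T, ∫ π, (M.meanReward M.bestDecision - M.meanReward π)
    ∂(alg.kernel t (fun i : Fin t => H (Fin.castLE t.isLt.le i)))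

/-- The Decision-Estimation Coefficient `dec_γ(S, Mbar)`. -/
def dec [Finite Act] [Nonempty Act] (γ : ℝ) (S : Set (Model Act Obs)) (Mbar : Model Act Obs) :
    EReal :=
  ⨅ p : ProbabilityMeasure Act, ⨆ M ∈ S,
    ((∫ π, (M.meanReward M.bestDecision - M.meanReward π
        - γ * hellingerSq (M.kernel π) (Mbar.kernel π)) ∂(p : Measure Act) : ℝ) : EReal)

/-- The part of the class `S` localized around `Mbar` at radius `ε`. -/
def localized [Finite Act] [Nonempty Act] (S : Set (Model Act Obs)) (ε : ℝ)
    (Mbar : Model Act Obs) : Set (Model Act Obs) :=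
  {M ∈ S | M.meanReward M.bestDecision - ε ≤ Mbar.meanReward Mbar.bestDecision}

/-- `V(S)`: the supremum of the likelihood ratios `M(A | π) / M'(A | π)`, or `e` if that is
larger. In `ℝ≥0∞` one has `0 / 0 = 0` and `a / 0 = ∞` for `a ≠ 0`. -/
def ratioBound (S : Set (Model Act Obs)) : ℝ≥0∞ :=
  (⨆ M ∈ S, ⨆ M' ∈ S, ⨆ π : Act, ⨆ A : Set (unitInterval × Obs), ⨆ _ : MeasurableSet A,
    M.kernel π A / M'.kernel π A) ⊔ ENNReal.ofReal (Real.exp 1)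

/-- `C(T) = 2⁹ log (T ∧ V(S))`. -/
def constC (S : Set (Model Act Obs)) (T : ℕ) : ℝ :=
  2 ^ 9 * Real.log (min (T : ℝ≥0∞) (ratioBound S)).toReal

/-- `ε_γ = γ / (4 C(T) T)`. -/
def radius (S : Set (Model Act Obs)) (T : ℕ) (γ : ℝ) : ℝ :=
  γ / (4 * constC S T * T)

end

end DMSO

end

/-! The expected regret alone already satisfies the bound, so the deviation term is only ever used
through its nonnegativity. The growth of `constC` is not needed either: only `35 ≤ constC S T`
enters.

Fix a reference model `N` and let `p` be the law of the decision in a uniformly random round played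
under `N`; this is the competitor in the infimum defining `dec`. For each `M` localized around `N`,
`mul_integral_gap_sub_le` bounds `T` times the objective at `p` by four times the regret under `M`
plus the regret under `N`. If every regret in the class is at most `b`, then `dec ≤ 5 b / T`, which
is incompatible with `b = dec * T / 8` when `dec > 0`.

The objective measures the gap of `M` along play under `N`, so a change of measure is needed. Let
`X` be the square root of the likelihood ratio of the history, `M` against `N`. Where `X ≥ 1/2`, the
law under `N` is at most four times that under `M`, and the regret of `M` transfers. Where `X <
1/2`, the gap of `M` is compared with that of `N` pointwise: localization costs `ε`, and the
difference of mean rewards costs `l H² + 1/l`. The constant part of this cost is multiplied by the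
probability of the event `X < 1/2`, which is at most `35/2` times the expected cumulative squared
Hellinger distance under `N`. Everything left is then absorbed by the penalty `γ H²`.

That probability bound comes from a bounded potential of `X`, zero at the start, at least `1/5` on
the event, with expected growth at most `7/2 H²` per round. Boundedness makes it work with no
control on likelihood ratios. -/

noncomputable section

namespace DMSO

/-! ### Scalar inequalities for the potential and for mean differences -/

/-- The potential `(1 - x)² / (1 + x²)`, a bounded surrogate for `(1 - x)²`. -/
def potential (x : ℝ) : ℝ := (1 - x) ^ 2 / (1 + x ^ 2)

theorem potential_one : potential 1 = 0 := by simp [potential]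

theorem potential_nonneg (x : ℝ) : 0 ≤ potential x := by unfold potential; positivity

theorem potential_le_two (x : ℝ) : potential x ≤ 2 := by
  unfold potential
  rw [div_le_iff₀ (by positivity)]
  nlinarith [sq_nonneg (1 + x)]

theorem measurable_potential : Measurable potential := by unfold potential; fun_prop

theorem one_le_five_mul_potential {x : ℝ} (h : x < 1 / 2) : 1 ≤ 5 * potential x := by
  unfold potential
  rw [← mul_div_assoc, le_div_iff₀ (by positivity)]
  nlinarith

/-- The slope `x ψ'(x)` of the potential `ψ` in logarithmic scale. -/
def potentialSlope (x : ℝ) : ℝ := -(2 * x * (1 - x ^ 2)) / (1 + x ^ 2) ^ 2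

theorem abs_potentialSlope_le (x : ℝ) : |potentialSlope x| ≤ 1 := by
  unfold potentialSlope
  rw [abs_div, abs_of_pos (by positivity : (0 : ℝ) < (1 + x ^ 2) ^ 2), div_le_one (by positivity),
    abs_le]
  constructor <;> nlinarith [sq_nonneg (1 - x ^ 2 - 2 * x), sq_nonneg (1 - x ^ 2 + 2 * x)]

/-- A first-order expansion in the multiplicative increment `y` around `1`, with a quadratic error
uniform in `x`: this uniformity is what lets the potential be iterated along the history. -/
theorem potential_mul_le {x y : ℝ} (hx : 0 ≤ x) (hy : 0 ≤ y) :
    potential (x * y) ≤ potential x + potentialSlope x * (y - 1) + 3 * (1 - y) ^ 2 := by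
  have hA : (0 : ℝ) < 1 + x ^ 2 := by positivity
  have hB : (0 : ℝ) < 1 + x ^ 2 * y ^ 2 := by positivity
  -- The remainder factors exactly as `(1 - y)²` times a rational function. In its numerator `4x³`
  -- is at most twice the denominator, `2x³y` at most once, and the remaining term is nonpositive;
  -- hence `3`.
  have key : potential (x * y) - potential x - potentialSlope x * (y - 1) =
      (1 - y) ^ 2 * (2 * x ^ 3 * (2 + y - x ^ 2 * y) / ((1 + x ^ 2) ^ 2 * (1 + x ^ 2 * y ^ 2))) := by
    unfold potential potentialSlope
    rw [mul_pow]
    field_simp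
    ring
  have hle : 2 * x ^ 3 * (2 + y - x ^ 2 * y) / ((1 + x ^ 2) ^ 2 * (1 + x ^ 2 * y ^ 2)) ≤ 3 := by
    rw [div_le_iff₀ (by positivity)]
    have h1 : 2 * x ≤ 1 + x ^ 2 := by nlinarith [sq_nonneg (1 - x)]
    have h2 : x ^ 2 ≤ 1 + x ^ 2 := by linarith
    have h3 : 2 * x * x ^ 2 ≤ (1 + x ^ 2) ^ 2 := by
      rw [sq (1 + x ^ 2)]; exact mul_le_mul h1 h2 (by positivity) (by positivity)
    have h4 : 2 * (x * y) ≤ 1 + x ^ 2 * y ^ 2 := by nlinarith [sq_nonneg (1 - x * y)]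
    have h5 : x ^ 2 ≤ (1 + x ^ 2) ^ 2 := by nlinarith [sq_nonneg (x ^ 2)]
    have h6 : x ^ 2 * (2 * (x * y)) ≤ (1 + x ^ 2) ^ 2 * (1 + x ^ 2 * y ^ 2) :=
      mul_le_mul h5 h4 (by positivity) (by positivity)
    have h7 : (2 * x * x ^ 2) * 1 ≤ (1 + x ^ 2) ^ 2 * (1 + x ^ 2 * y ^ 2) :=
      mul_le_mul h3 (by nlinarith [sq_nonneg (x * y)]) (by positivity) (by positivity)
    have h8 : 0 ≤ 2 * x ^ 3 * (x ^ 2 * y) := by positivity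
    nlinarith
  nlinarith [mul_le_mul_of_nonneg_left hle (sq_nonneg (1 - y))]

/-- Complete the square in `a - b`, after writing `a² - b² = (a - b)(a + b)`. It is applied with
`a`, `b` the square roots of two densities and `r` the reward. -/
theorem sub_sq_mul_le {r l : ℝ} (h0 : 0 ≤ r) (h1 : r ≤ 1) (hl : 0 < l) (a b : ℝ) :
    (a ^ 2 - b ^ 2) * r ≤ l * (a - b) ^ 2 + 1 / (2 * l) * (a ^ 2 + b ^ 2) := by
  have h2 : (a ^ 2 - b ^ 2) * r ≤ l * (a - b) ^ 2 + 1 / (4 * l) * (a + b) ^ 2 * r ^ 2 := by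
    have : l * (a - b) ^ 2 + 1 / (4 * l) * (a + b) ^ 2 * r ^ 2 - (a ^ 2 - b ^ 2) * r =
        l * ((a - b) - (a + b) * r / (2 * l)) ^ 2 := by
      field_simp
      ring
    have : 0 ≤ l * ((a - b) - (a + b) * r / (2 * l)) ^ 2 := by positivity
    linarith
  have h3 : 1 / (4 * l) * (a + b) ^ 2 * r ^ 2 ≤ 1 / (2 * l) * (a ^ 2 + b ^ 2) := by
    have h4 : r ^ 2 ≤ 1 := pow_le_one₀ h0 h1
    have h5 : (a + b) ^ 2 * r ^ 2 ≤ 2 * (a ^ 2 + b ^ 2) := by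
      nlinarith [sq_nonneg (a - b), mul_le_mul_of_nonneg_left h4 (sq_nonneg (a + b))]
    calc _ = 1 / (4 * l) * ((a + b) ^ 2 * r ^ 2) := by ring
      _ ≤ 1 / (4 * l) * (2 * (a ^ 2 + b ^ 2)) := by gcongr
      _ = _ := by field_simp; ring
  linarith

/-! ### One round: Hellinger distance and square-root likelihood ratios -/

section Hellinger

variable {X : Type*} [MeasurableSpace X] (P Q : Measure X)

/-- The square root of the density of `Q` with respect to `P` (of its absolutely continuous
part). -/
def sqrtRatio (x : X) : ℝ :=
  √((Q.rnDeriv (P + Q) x).toReal / (P.rnDeriv (P + Q) x).toReal)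

theorem sqrtRatio_nonneg (x : X) : 0 ≤ sqrtRatio P Q x := Real.sqrt_nonneg _

theorem measurable_sqrtRatio : Measurable (sqrtRatio P Q) := by
  unfold sqrtRatio
  fun_prop

theorem hellingerSq_nonneg : 0 ≤ hellingerSq P Q :=
  integral_nonneg fun _ => sq_nonneg _

theorem hellingerSq_comm : hellingerSq P Q = hellingerSq Q P := by
  unfold hellingerSq
  rw [add_comm Q P]
  exact integral_congr_ae (.of_forall fun x => by ring)

theorem absolutelyContinuous_add_left : P ≪ P + Q :=
  Measure.absolutelyContinuous_of_le (Measure.le_add_right le_rfl)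

theorem absolutelyContinuous_add_right : Q ≪ P + Q :=
  Measure.absolutelyContinuous_of_le (Measure.le_add_left le_rfl)

theorem sub_sq_sqrt_density (x : X) :
    (√(P.rnDeriv (P + Q) x).toReal - √(Q.rnDeriv (P + Q) x).toReal) ^ 2 =
      (P.rnDeriv (P + Q) x).toReal + (Q.rnDeriv (P + Q) x).toReal
        - 2 * (√(P.rnDeriv (P + Q) x).toReal * √(Q.rnDeriv (P + Q) x).toReal) := by
  have hp := Real.sq_sqrt (ENNReal.toReal_nonneg (a := P.rnDeriv (P + Q) x))
  have hq := Real.sq_sqrt (ENNReal.toReal_nonneg (a := Q.rnDeriv (P + Q) x))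
  linear_combination hp + hq

theorem density_mul_sqrtRatio (x : X) :
    (P.rnDeriv (P + Q) x).toReal * sqrtRatio P Q x =
      √(P.rnDeriv (P + Q) x).toReal * √(Q.rnDeriv (P + Q) x).toReal := by
  unfold sqrtRatio
  rw [Real.sqrt_div ENNReal.toReal_nonneg]
  have hp := Real.mul_self_sqrt (ENNReal.toReal_nonneg (a := P.rnDeriv (P + Q) x))
  set a := √(P.rnDeriv (P + Q) x).toReal
  rw [← hp]
  by_cases ha : a = 0
  · simp [ha]
  · field_simp

theorem density_mul_sqrtRatio_sq_le (x : X) :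
    (P.rnDeriv (P + Q) x).toReal * sqrtRatio P Q x ^ 2 ≤ (Q.rnDeriv (P + Q) x).toReal := by
  unfold sqrtRatio
  rw [Real.sq_sqrt (by positivity)]
  by_cases hp : (P.rnDeriv (P + Q) x).toReal = 0
  · simp [hp]
  · rw [mul_div_cancel₀ _ hp]

theorem density_mul_one_sub_sqrtRatio_sq_le (x : X) :
    (P.rnDeriv (P + Q) x).toReal * (1 - sqrtRatio P Q x) ^ 2 ≤
      (√(P.rnDeriv (P + Q) x).toReal - √(Q.rnDeriv (P + Q) x).toReal) ^ 2 := by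
  rw [sub_sq_sqrt_density]
  nlinarith [density_mul_sqrtRatio P Q x, density_mul_sqrtRatio_sq_le P Q x]

variable [IsProbabilityMeasure P] [IsProbabilityMeasure Q]

theorem integral_density_mul_left (f : X → ℝ) :
    ∫ x, (P.rnDeriv (P + Q) x).toReal * f x ∂(P + Q) = ∫ x, f x ∂P :=
  integral_rnDeriv_smul (absolutelyContinuous_add_left P Q)

theorem integral_density_mul_right (f : X → ℝ) :
    ∫ x, (Q.rnDeriv (P + Q) x).toReal * f x ∂(P + Q) = ∫ x, f x ∂Q :=
  integral_rnDeriv_smul (absolutelyContinuous_add_right P Q)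

theorem integral_density_left : ∫ x, (P.rnDeriv (P + Q) x).toReal ∂(P + Q) = 1 := by
  simpa using integral_density_mul_left P Q fun _ => 1

theorem integral_density_right : ∫ x, (Q.rnDeriv (P + Q) x).toReal ∂(P + Q) = 1 := by
  simpa using integral_density_mul_right P Q fun _ => 1

theorem integrable_sqrt_density_mul :
    Integrable (fun x => √(P.rnDeriv (P + Q) x).toReal * √(Q.rnDeriv (P + Q) x).toReal)
      (P + Q) := by
  have h := (Measure.integrable_toReal_rnDeriv (μ := P) (ν := P + Q)).add
    (Measure.integrable_toReal_rnDeriv (μ := Q) (ν := P + Q))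
  refine h.mono' (Measurable.aestronglyMeasurable (by fun_prop)) (.of_forall fun x => ?_)
  rw [Real.norm_of_nonneg (by positivity)]
  have hp := Real.sq_sqrt (ENNReal.toReal_nonneg (a := P.rnDeriv (P + Q) x))
  have hq := Real.sq_sqrt (ENNReal.toReal_nonneg (a := Q.rnDeriv (P + Q) x))
  simp only [Pi.add_apply]
  nlinarith [sq_nonneg (√(P.rnDeriv (P + Q) x).toReal - √(Q.rnDeriv (P + Q) x).toReal),
    Real.sqrt_nonneg (P.rnDeriv (P + Q) x).toReal, Real.sqrt_nonneg (Q.rnDeriv (P + Q) x).toReal]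

theorem integrable_sub_sq_sqrt_density :
    Integrable (fun x => (√(P.rnDeriv (P + Q) x).toReal - √(Q.rnDeriv (P + Q) x).toReal) ^ 2)
      (P + Q) := by
  simp_rw [sub_sq_sqrt_density]
  exact (Measure.integrable_toReal_rnDeriv.add Measure.integrable_toReal_rnDeriv).sub
    ((integrable_sqrt_density_mul P Q).const_mul 2)

theorem hellingerSq_eq :
    hellingerSq P Q = 2 - 2 *
      ∫ x, √(P.rnDeriv (P + Q) x).toReal * √(Q.rnDeriv (P + Q) x).toReal ∂(P + Q) := by
  unfold hellingerSq
  simp_rw [sub_sq_sqrt_density]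
  have hs : Integrable (fun x => (P.rnDeriv (P + Q) x).toReal + (Q.rnDeriv (P + Q) x).toReal)
      (P + Q) := Measure.integrable_toReal_rnDeriv.add Measure.integrable_toReal_rnDeriv
  rw [integral_sub hs ((integrable_sqrt_density_mul P Q).const_mul 2), integral_add
    Measure.integrable_toReal_rnDeriv Measure.integrable_toReal_rnDeriv, integral_const_mul,
    integral_density_left, integral_density_right]
  norm_num

/-- An equality even without absolute continuity, since a part of `Q` singular to `P` contributes
nothing to the affinity `∫ √(pq)`. -/
theorem integral_sqrtRatio : ∫ x, sqrtRatio P Q x ∂P = 1 - hellingerSq P Q / 2 := by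
  rw [← integral_density_mul_left P Q, hellingerSq_eq]
  simp_rw [density_mul_sqrtRatio]
  ring

theorem integrable_sqrtRatio : Integrable (sqrtRatio P Q) P := by
  rw [← integrable_rnDeriv_smul_iff (absolutelyContinuous_add_left P Q)]
  simp_rw [smul_eq_mul, density_mul_sqrtRatio]
  exact integrable_sqrt_density_mul P Q

theorem integrable_one_sub_sqrtRatio_sq : Integrable (fun x => (1 - sqrtRatio P Q x) ^ 2) P := by
  rw [← integrable_rnDeriv_smul_iff (absolutelyContinuous_add_left P Q)]
  refine (integrable_sub_sq_sqrt_density P Q).mono' (Measurable.aestronglyMeasurable ?_)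
    (.of_forall fun x => ?_)
  · have := measurable_sqrtRatio P Q
    simp only [smul_eq_mul]
    fun_prop
  · rw [smul_eq_mul, Real.norm_of_nonneg (by positivity)]
    exact density_mul_one_sub_sqrtRatio_sq_le P Q x

/-- Only an inequality: the Hellinger distance also counts the mass of `Q` on the set where the
density of `P` vanishes. -/
theorem integral_one_sub_sqrtRatio_sq_le :
    ∫ x, (1 - sqrtRatio P Q x) ^ 2 ∂P ≤ hellingerSq P Q := by
  rw [← integral_density_mul_left P Q]
  exact integral_mono
    ((integrable_rnDeriv_smul_iff (absolutelyContinuous_add_left P Q)).2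
      (integrable_one_sub_sqrtRatio_sq P Q))
    (integrable_sub_sq_sqrt_density P Q) (density_mul_one_sub_sqrtRatio_sq_le P Q)

/-- One-round drift. The linear term has mean `-H²/2` times a slope of modulus at most `1`, and the
quadratic term costs at most `3 H²`; together `7/2 H²`. -/
theorem integral_potential_mul_sqrtRatio_le {c : ℝ} (hc : 0 ≤ c) :
    ∫ x, potential (c * sqrtRatio P Q x) ∂P ≤ potential c + 7 / 2 * hellingerSq P Q := by
  have hi : Integrable (fun x => potential c + potentialSlope c * (sqrtRatio P Q x - 1)) P :=
    (integrable_const _).add (((integrable_sqrtRatio P Q).sub (integrable_const _)).const_mul _)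
  have hj := (integrable_one_sub_sqrtRatio_sq P Q).const_mul 3
  have h1 : ∫ x, potential (c * sqrtRatio P Q x) ∂P ≤ ∫ x, (potential c
      + potentialSlope c * (sqrtRatio P Q x - 1) + 3 * (1 - sqrtRatio P Q x) ^ 2) ∂P := by
    refine integral_mono_of_nonneg (.of_forall fun x => potential_nonneg _) (hi.add hj)
      (.of_forall fun x => potential_mul_le hc (sqrtRatio_nonneg P Q x))
  rw [integral_add hi hj, integral_add (integrable_const _) (by
    exact ((integrable_sqrtRatio P Q).sub (integrable_const _)).const_mul _), integral_const_mul,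
    integral_const_mul, integral_sub (integrable_sqrtRatio P Q) (integrable_const _),
    integral_sqrtRatio] at h1
  simp only [integral_const, probReal_univ, smul_eq_mul, one_mul] at h1
  have h2 := integral_one_sub_sqrtRatio_sq_le P Q
  have h3 := abs_le.1 (abs_potentialSlope_le c)
  nlinarith [hellingerSq_nonneg P Q]

theorem lintegral_mul_sqrtRatio_sq_le {h : X → ℝ≥0∞} (hh : Measurable h) :
    ∫⁻ x, h x * ENNReal.ofReal (sqrtRatio P Q x ^ 2) ∂P ≤ ∫⁻ x, h x ∂Q := by
  have hm := measurable_sqrtRatio P Q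
  rw [← lintegral_rnDeriv_mul (absolutelyContinuous_add_left P Q) (by fun_prop),
    ← lintegral_rnDeriv_mul (absolutelyContinuous_add_right P Q) (by fun_prop)]
  refine lintegral_mono_ae ?_
  filter_upwards [Measure.rnDeriv_lt_top P (P + Q), Measure.rnDeriv_lt_top Q (P + Q)] with x hp hq
  have : P.rnDeriv (P + Q) x * ENNReal.ofReal (sqrtRatio P Q x ^ 2) ≤ Q.rnDeriv (P + Q) x := by
    rw [← ENNReal.ofReal_toReal hp.ne, ← ENNReal.ofReal_toReal hq.ne,
      ← ENNReal.ofReal_mul ENNReal.toReal_nonneg]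
    exact ENNReal.ofReal_le_ofReal (density_mul_sqrtRatio_sq_le P Q x)
  calc _ = h x * (P.rnDeriv (P + Q) x * ENNReal.ofReal (sqrtRatio P Q x ^ 2)) := by ring
    _ ≤ h x * Q.rnDeriv (P + Q) x := by gcongr
    _ = _ := mul_comm _ _

theorem integral_sub_integral_le {r : X → ℝ} (hr : Measurable r) (h0 : ∀ x, 0 ≤ r x)
    (h1 : ∀ x, r x ≤ 1) {l : ℝ} (hl : 0 < l) :
    ∫ x, r x ∂P - ∫ x, r x ∂Q ≤ l * hellingerSq P Q + 1 / l := by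
  have hb : ∀ x, ‖r x‖ ≤ 1 := fun x => by rw [Real.norm_of_nonneg (h0 x)]; exact h1 x
  have hiP : Integrable r P := .of_bound hr.aestronglyMeasurable 1 (.of_forall hb)
  have hiQ : Integrable r Q := .of_bound hr.aestronglyMeasurable 1 (.of_forall hb)
  have hjP := (integrable_rnDeriv_smul_iff (absolutelyContinuous_add_left P Q)).2 hiP
  have hjQ := (integrable_rnDeriv_smul_iff (absolutelyContinuous_add_right P Q)).2 hiQ
  rw [← integral_density_mul_left P Q, ← integral_density_mul_right P Q, ← integral_sub
    (by exact hjP) (by exact hjQ)]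
  have hs : Integrable (fun x => 1 / (2 * l) *
      ((P.rnDeriv (P + Q) x).toReal + (Q.rnDeriv (P + Q) x).toReal)) (P + Q) :=
    (Measure.integrable_toReal_rnDeriv.add Measure.integrable_toReal_rnDeriv).const_mul _
  have hd := (integrable_sub_sq_sqrt_density P Q).const_mul l
  have : l * hellingerSq P Q + 1 / l = ∫ x,
      (l * (√(P.rnDeriv (P + Q) x).toReal - √(Q.rnDeriv (P + Q) x).toReal) ^ 2
      + 1 / (2 * l) * ((P.rnDeriv (P + Q) x).toReal + (Q.rnDeriv (P + Q) x).toReal))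
      ∂(P + Q) := by
    rw [integral_add hd hs, integral_const_mul, integral_const_mul, integral_add
      Measure.integrable_toReal_rnDeriv Measure.integrable_toReal_rnDeriv,
      integral_density_left, integral_density_right]
    unfold hellingerSq
    field_simp
    ring
  rw [this]
  refine integral_mono (hjP.sub hjQ) (hd.add hs) fun x => ?_
  have hp := Real.sq_sqrt (ENNReal.toReal_nonneg (a := P.rnDeriv (P + Q) x))
  have hq := Real.sq_sqrt (ENNReal.toReal_nonneg (a := Q.rnDeriv (P + Q) x))
  rw [← hp, ← hq, ← sub_mul]
  simp only [Real.sqrt_sq (Real.sqrt_nonneg _)]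
  exact sub_sq_mul_le (h0 x) (h1 x) hl _ _

end Hellinger

theorem exists_abs_le {α : Type*} [Finite α] (u : α → ℝ) : ∃ K, ∀ a, |u a| ≤ K :=
  (Set.finite_range fun a => |u a|).bddAbove.imp fun _ h a => h ⟨a, rfl⟩

/-! ### Histories: cumulative costs and likelihood ratios along the interaction -/

section History

variable {Act Obs : Type*} [MeasurableSpace Act] [MeasurableSpace Obs] {T : ℕ}

theorem measurable_snoc (t : ℕ) :
    Measurable fun x : (Fin t → Round Act Obs) × Round Act Obs =>
      (Fin.snoc x.1 x.2 : Fin (t + 1) → Round Act Obs) := by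
  refine measurable_pi_iff.2 fun i => ?_
  refine Fin.lastCases ?_ (fun j => ?_) i
  · simpa using measurable_snd
  · simp only [Fin.snoc_castSucc]
    exact (measurable_pi_apply j).comp measurable_fst

instance isMarkovKernel_kernel_mk (alg : Algorithm Act Obs T) (t : ℕ) (ht : t < T) :
    IsMarkovKernel (α := Fin t → Round Act Obs) (alg.kernel ⟨t, ht⟩) :=
  alg.isMarkov ⟨t, ht⟩

instance isProbabilityMeasure_historyLaw (alg : Algorithm Act Obs T) (M : Model Act Obs) (t : ℕ)
    (ht : t ≤ T) : IsProbabilityMeasure (historyLaw alg M t ht) := by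
  induction t with
  | zero => exact Measure.dirac.isProbabilityMeasure
  | succ t ih =>
    have := ih (Nat.le_of_succ_le ht)
    exact Measure.isProbabilityMeasure_map (measurable_snoc t).aemeasurable

instance isProbabilityMeasure_fullLaw (alg : Algorithm Act Obs T) (M : Model Act Obs) :
    IsProbabilityMeasure (fullLaw alg M) :=
  isProbabilityMeasure_historyLaw alg M T le_rfl

theorem lintegral_historyLaw_succ (alg : Algorithm Act Obs T) (M : Model Act Obs) {t : ℕ}
    (ht : t + 1 ≤ T) {f : (Fin (t + 1) → Round Act Obs) → ℝ≥0∞} (hf : Measurable f) :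
    ∫⁻ H, f H ∂historyLaw alg M (t + 1) ht =
      ∫⁻ H, ∫⁻ π, ∫⁻ z, f (Fin.snoc H (π, z) : Fin (t + 1) → Round Act Obs) ∂M.kernel π
        ∂alg.kernel ⟨t, ht⟩ H ∂historyLaw alg M t (Nat.le_of_succ_le ht) := by
  rw [historyLaw, lintegral_map hf (measurable_snoc t),
    Measure.lintegral_compProd (f := fun x : (Fin t → Round Act Obs) × Round Act Obs =>
      f (Fin.snoc x.1 x.2)) (hf.comp (measurable_snoc t))]
  refine lintegral_congr fun H => ?_
  rw [Kernel.lintegral_compProd (f := fun x => f (Fin.snoc H x : Fin (t + 1) → Round Act Obs)) _ _ _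
    ((hf.comp (measurable_snoc t)).comp (measurable_const.prodMk measurable_id))]
  rfl

theorem integral_historyLaw_succ (alg : Algorithm Act Obs T) (M : Model Act Obs) {t : ℕ}
    (ht : t + 1 ≤ T) {f : (Fin (t + 1) → Round Act Obs) → ℝ} (hf : Measurable f) {K : ℝ}
    (hK : ∀ H, |f H| ≤ K) :
    ∫ H, f H ∂historyLaw alg M (t + 1) ht =
      ∫ H, ∫ π, ∫ z, f (Fin.snoc H (π, z) : Fin (t + 1) → Round Act Obs) ∂M.kernel π
        ∂alg.kernel ⟨t, ht⟩ H ∂historyLaw alg M t (Nat.le_of_succ_le ht) := by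
  have hm := hf.comp (measurable_snoc (Act := Act) (Obs := Obs) t)
  rw [historyLaw, integral_map (measurable_snoc t).aemeasurable hf.aestronglyMeasurable,
    Measure.integral_compProd (f := fun x : (Fin t → Round Act Obs) × Round Act Obs =>
      f (Fin.snoc x.1 x.2)) (.of_bound hm.aestronglyMeasurable K (.of_forall fun _ => hK _))]
  refine integral_congr_ae (.of_forall fun H => ?_)
  refine (integral_compProd (f := fun x => f (Fin.snoc H x : Fin (t + 1) → Round Act Obs))
    (.of_bound ?_ K (.of_forall fun _ => hK _))).trans rfl
  exact (hm.comp (measurable_const.prodMk measurable_id)).aestronglyMeasurable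

/-- The sum over the first `t` rounds of the conditional expectations `E_{π ∼ p_s}[u(π)]`. -/
def cumulative (alg : Algorithm Act Obs T) (u : Act → ℝ) (t : ℕ) (ht : t ≤ T)
    (H : Fin t → Round Act Obs) : ℝ :=
  ∑ s : Fin t, ∫ π, u π ∂alg.kernel ⟨s, s.isLt.trans_le ht⟩
    (fun i : Fin s => H (Fin.castLE s.isLt.le i))

theorem cumulative_snoc (alg : Algorithm Act Obs T) (u : Act → ℝ) {t : ℕ} (ht : t + 1 ≤ T)
    (H : Fin t → Round Act Obs) (x : Round Act Obs) :
    cumulative alg u (t + 1) ht (Fin.snoc H x) =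
      cumulative alg u t (Nat.le_of_succ_le ht) H + ∫ π, u π ∂alg.kernel ⟨t, ht⟩ H := by
  -- Every sampling distribution up to index `t` reads only the first `t` rounds, so none of them
  -- sees the appended one.
  have key : ∀ (s : ℕ) (hs : s ≤ t) (i : Fin s),
      (Fin.snoc H x : Fin (t + 1) → Round Act Obs) (Fin.castLE (by omega) i) =
        H (Fin.castLE hs i) := fun s hs i =>
    Fin.snoc_castSucc (α := fun _ => Round Act Obs) x H (Fin.castLE hs i)
  unfold cumulative
  rw [Fin.sum_univ_castSucc]
  congr 1
  · refine Finset.sum_congr rfl fun s _ => ?_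
    congr 2
    exact funext fun i => key s s.isLt.le i
  · congr 2
    exact funext fun i => key t le_rfl i

/-- The law of a decision drawn in a uniformly random round of the interaction with `M`. -/
def averageDecision (alg : Algorithm Act Obs T) (M : Model Act Obs) : Measure Act :=
  (T : ℝ≥0∞)⁻¹ • ∑ s : Fin T, (((alg.kernel s).comap
    (fun (H : Fin T → Round Act Obs) (i : Fin s) => H (Fin.castLE s.isLt.le i))
    (measurable_pi_iff.2 fun _ => measurable_pi_apply _)) ∘ₖ Kernel.const Unit (fullLaw alg M)) ()

theorem isProbabilityMeasure_averageDecision (hT : T ≠ 0) (alg : Algorithm Act Obs T)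
    (M : Model Act Obs) : IsProbabilityMeasure (averageDecision alg M) := by
  constructor
  simp only [averageDecision, Measure.smul_apply, Measure.finsetSum_apply, measure_univ]
  simp [ENNReal.inv_mul_cancel, hT]

/-- The square root of the likelihood ratio of a history under `M` and under `N`. -/
def pathRatio (N M : Model Act Obs) (t : ℕ) (H : Fin t → Round Act Obs) : ℝ :=
  ∏ s : Fin t, sqrtRatio (N.kernel (H s).1) (M.kernel (H s).1) (H s).2

theorem pathRatio_nonneg (N M : Model Act Obs) (t : ℕ) (H : Fin t → Round Act Obs) :
    0 ≤ pathRatio N M t H :=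
  Finset.prod_nonneg fun _ _ => sqrtRatio_nonneg _ _ _

theorem pathRatio_snoc (N M : Model Act Obs) (t : ℕ) (H : Fin t → Round Act Obs)
    (x : Round Act Obs) :
    pathRatio N M (t + 1) (Fin.snoc H x) =
      pathRatio N M t H * sqrtRatio (N.kernel x.1) (M.kernel x.1) x.2 := by
  simp [pathRatio, Fin.prod_univ_castSucc]

theorem abs_integral_kernel_le (alg : Algorithm Act Obs T) {u : Act → ℝ} {K : ℝ}
    (hK : ∀ π, |u π| ≤ K) (s : Fin T) (H : Fin s → Round Act Obs) :
    |∫ π, u π ∂alg.kernel s H| ≤ K := by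
  simpa using norm_integral_le_of_norm_le_const (μ := alg.kernel s H) (f := u) (.of_forall hK)

theorem abs_cumulative_le (alg : Algorithm Act Obs T) {u : Act → ℝ} {K : ℝ}
    (hK : ∀ π, |u π| ≤ K) (t : ℕ) (ht : t ≤ T) (H : Fin t → Round Act Obs) :
    |cumulative alg u t ht H| ≤ t * K := by
  refine (Finset.abs_sum_le_sum_abs _ _).trans ?_
  refine (Finset.sum_le_card_nsmul _ _ K fun s _ => abs_integral_kernel_le alg hK _ _).trans ?_
  simp

variable [Finite Act] [MeasurableSingletonClass Act]

theorem measurable_integral_kernel (alg : Algorithm Act Obs T) (u : Act → ℝ) (s : Fin T) :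
    Measurable fun H => ∫ π, u π ∂alg.kernel s H :=
  ((measurable_of_finite u).stronglyMeasurable.integral_kernel (κ := alg.kernel s)).measurable

theorem measurable_cumulative (alg : Algorithm Act Obs T) (u : Act → ℝ) (t : ℕ) (ht : t ≤ T) :
    Measurable (cumulative alg u t ht) := by
  refine Finset.measurable_fun_sum _ fun s _ => ?_
  exact (measurable_integral_kernel alg u _).comp
    (measurable_pi_iff.2 fun i => measurable_pi_apply _)

theorem integrable_integral_kernel (alg : Algorithm Act Obs T) (u : Act → ℝ) (s : Fin T)
    (μ : Measure (Fin s → Round Act Obs)) [IsFiniteMeasure μ] :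
    Integrable (fun H => ∫ π, u π ∂alg.kernel s H) μ := by
  obtain ⟨K, hK⟩ := exists_abs_le u
  exact .of_bound (measurable_integral_kernel alg u s).aestronglyMeasurable K
    (.of_forall fun H => abs_integral_kernel_le alg hK s H)

theorem integrable_cumulative (alg : Algorithm Act Obs T) (u : Act → ℝ) (t : ℕ) (ht : t ≤ T)
    (μ : Measure (Fin t → Round Act Obs)) [IsFiniteMeasure μ] :
    Integrable (cumulative alg u t ht) μ := by
  obtain ⟨K, hK⟩ := exists_abs_le u
  exact .of_bound (measurable_cumulative alg u t ht).aestronglyMeasurable _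
    (.of_forall fun H => abs_cumulative_le alg hK t ht H)

theorem integral_cumulative_succ (alg : Algorithm Act Obs T) (M : Model Act Obs) (u : Act → ℝ)
    {t : ℕ} (ht : t + 1 ≤ T) :
    ∫ H, cumulative alg u (t + 1) ht H ∂historyLaw alg M (t + 1) ht =
      ∫ H, cumulative alg u t (Nat.le_of_succ_le ht) H
          ∂historyLaw alg M t (Nat.le_of_succ_le ht) +
        ∫ H, ∫ π, u π ∂alg.kernel ⟨t, ht⟩ H ∂historyLaw alg M t (Nat.le_of_succ_le ht) := by
  obtain ⟨K, hK⟩ := exists_abs_le u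
  rw [integral_historyLaw_succ alg M ht (measurable_cumulative alg u _ ht)
    (abs_cumulative_le alg hK _ ht), ← integral_add (integrable_cumulative alg u _ _ _)
    (integrable_integral_kernel alg u ⟨t, ht⟩ _)]
  simp [cumulative_snoc]

theorem cumulative_mono (alg : Algorithm Act Obs T) {u v : Act → ℝ} (h : ∀ π, u π ≤ v π) (t : ℕ)
    (ht : t ≤ T) (H : Fin t → Round Act Obs) :
    cumulative alg u t ht H ≤ cumulative alg v t ht H :=
  Finset.sum_le_sum fun _ _ => integral_mono .of_finite .of_finite h

theorem mul_integral_averageDecision (hT : T ≠ 0) (alg : Algorithm Act Obs T) (M : Model Act Obs)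
    (u : Act → ℝ) :
    T * ∫ π, u π ∂averageDecision alg M =
      ∫ H, cumulative alg u T le_rfl H ∂fullLaw alg M := by
  unfold averageDecision cumulative
  rw [integral_smul_measure, integral_finsetSum_measure fun _ _ => .of_finite,
    integral_finsetSum]
  · simp_rw [Kernel.integral_comp (Integrable.of_finite (f := u))]
    simp [hT]
  · intro s _
    obtain ⟨K, hK⟩ := exists_abs_le u
    refine .of_bound (Measurable.aestronglyMeasurable ?_) K
      (.of_forall fun H => abs_integral_kernel_le alg hK s _)
    exact (measurable_integral_kernel alg u s).comp
      (measurable_pi_iff.2 fun i => measurable_pi_apply _)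

theorem measurable_pathRatio (N M : Model Act Obs) (t : ℕ) : Measurable (pathRatio N M t) := by
  refine Finset.measurable_fun_prod _ fun s _ => ?_
  -- The densities are chosen separately for each decision; joint measurability is available because
  -- there are only countably many decisions.
  have : Measurable fun x : Round Act Obs => sqrtRatio (N.kernel x.1) (M.kernel x.1) x.2 :=
    measurable_from_prod_countable_right fun π =>
      measurable_sqrtRatio (N.kernel π) (M.kernel π)
  exact this.comp (measurable_pi_apply s)

/-- The potential starts at `0` because the empty product is `1`; conditioning on the past and
summing the one-round drifts gives the bound. -/
theorem integral_potential_pathRatio_le (alg : Algorithm Act Obs T) (N M : Model Act Obs) (t : ℕ)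
    (ht : t ≤ T) :
    ∫ H, potential (pathRatio N M t H) ∂historyLaw alg N t ht ≤
      7 / 2 * ∫ H, cumulative alg (fun π => hellingerSq (N.kernel π) (M.kernel π)) t ht H
        ∂historyLaw alg N t ht := by
  induction t with
  | zero => simp [pathRatio, cumulative, potential_one]
  | succ t ih =>
    have ih := ih (Nat.le_of_succ_le ht)
    have hm : ∀ t, Measurable fun H => potential (pathRatio N M t H) := fun t =>
      measurable_potential.comp (measurable_pathRatio N M t)
    have hb : ∀ x, |potential x| ≤ 2 := fun x => by
      rw [abs_of_nonneg (potential_nonneg x)]; exact potential_le_two x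
    set u : Act → ℝ := fun π => hellingerSq (N.kernel π) (M.kernel π)
    have hi : Integrable (fun H => potential (pathRatio N M t H))
        (historyLaw alg N t (Nat.le_of_succ_le ht)) :=
      .of_bound (hm t).aestronglyMeasurable 2 (.of_forall fun _ => hb _)
    have hu := integrable_integral_kernel alg u ⟨t, ht⟩
      (historyLaw alg N t (Nat.le_of_succ_le ht))
    rw [integral_cumulative_succ, integral_historyLaw_succ alg N ht (hm _) fun _ => hb _]
    simp_rw [pathRatio_snoc]
    refine le_trans (b := ∫ H, (potential (pathRatio N M t H) +
        7 / 2 * ∫ π, u π ∂alg.kernel ⟨t, ht⟩ H) ∂historyLaw alg N t (Nat.le_of_succ_le ht)) ?_ ?_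
    · refine integral_mono_of_nonneg (.of_forall fun H => integral_nonneg fun π =>
        integral_nonneg fun z => potential_nonneg _) (hi.add (hu.const_mul _))
        (.of_forall fun H => ?_)
      refine (integral_mono (g := fun π => potential (pathRatio N M t H) + 7 / 2 * u π)
        .of_finite .of_finite fun π =>
        integral_potential_mul_sqrtRatio_le _ _ (pathRatio_nonneg N M t H)).trans ?_
      rw [integral_add .of_finite .of_finite, integral_const_mul]
      simp
    · rw [integral_add hi (hu.const_mul _), integral_const_mul]
      linarith

/-- The squared path ratio is a likelihood ratio in which the singular part of `M` is dropped, hence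
an inequality. In the induction the last round is integrated out under `M`, and the resulting
function of the first `t` rounds replaces `h`. -/
theorem lintegral_mul_pathRatio_sq_le (alg : Algorithm Act Obs T) (N M : Model Act Obs) (t : ℕ)
    (ht : t ≤ T) {h : (Fin t → Round Act Obs) → ℝ≥0∞} (hh : Measurable h) :
    ∫⁻ H, h H * ENNReal.ofReal (pathRatio N M t H ^ 2) ∂historyLaw alg N t ht ≤
      ∫⁻ H, h H ∂historyLaw alg M t ht := by
  induction t with
  | zero => simp [pathRatio, historyLaw]
  | succ t ih =>
    have hr := measurable_pathRatio N M
    have hs := hh.comp (measurable_snoc (Act := Act) (Obs := Obs) t)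
    have hz : ∀ H π, Measurable fun z =>
        h (Fin.snoc H (π, z) : Fin (t + 1) → Round Act Obs) := fun H π =>
      hs.comp (measurable_const.prodMk (measurable_const.prodMk measurable_id))
    rw [lintegral_historyLaw_succ alg N ht (by fun_prop), lintegral_historyLaw_succ alg M ht hh]
    refine le_trans ?_ (ih (Nat.le_of_succ_le ht) ?_)
    · refine lintegral_mono fun H => ?_
      rw [← lintegral_mul_const' _ _ ENNReal.ofReal_ne_top]
      refine lintegral_mono fun π => ?_
      simp_rw [pathRatio_snoc, mul_pow, ENNReal.ofReal_mul (sq_nonneg (pathRatio N M t H)),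
        mul_left_comm _ (ENNReal.ofReal (pathRatio N M t H ^ 2))]
      rw [lintegral_const_mul' _ _ ENNReal.ofReal_ne_top, mul_comm (lintegral _ _)]
      exact mul_le_mul' le_rfl (lintegral_mul_sqrtRatio_sq_le (N.kernel π) (M.kernel π) (hz H π))
    · have h1 : Measurable fun x : (Fin t → Round Act Obs) × Act =>
          ∫⁻ z, h (Fin.snoc x.1 (x.2, z) : Fin (t + 1) → Round Act Obs) ∂M.kernel x.2 :=
        Measurable.lintegral_kernel_prod_right' (κ := M.kernel.prodMkLeft (Fin t → Round Act Obs))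
          (f := fun y : ((Fin t → Round Act Obs) × Act) × (unitInterval × Obs) =>
            h (Fin.snoc y.1.1 (y.1.2, y.2) : Fin (t + 1) → Round Act Obs))
          (hs.comp (by fun_prop : Measurable
            fun y : ((Fin t → Round Act Obs) × Act) × (unitInterval × Obs) =>
              (y.1.1, (y.1.2, y.2))))
      exact h1.lintegral_kernel_prod_right' (κ := alg.kernel ⟨t, ht⟩)

end History

/-! ### Transfer of the regret of `M` from play under `N` to play under `M` -/

section ChangeOfMeasure

variable {Act Obs : Type*} [MeasurableSpace Act] [MeasurableSpace Obs] {T : ℕ} [Finite Act]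
  [MeasurableSingletonClass Act]

/-- Markov's inequality for the potential, which is at least `1/5` on this event: `35/2 = 5 * 7/2`.
-/
theorem measureReal_pathRatio_lt_le (alg : Algorithm Act Obs T) (N M : Model Act Obs) :
    (fullLaw alg N).real {H | pathRatio N M T H < 1 / 2} ≤ 35 / 2 *
      ∫ H, cumulative alg (fun π => hellingerSq (N.kernel π) (M.kernel π)) T le_rfl H
        ∂fullLaw alg N := by
  have hm := measurable_pathRatio N M T
  have h1 : (fullLaw alg N).real {H | pathRatio N M T H < 1 / 2} ≤
      ∫ H, 5 * potential (pathRatio N M T H) ∂fullLaw alg N := by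
    rw [← integral_indicator_one (measurableSet_lt hm measurable_const)]
    refine integral_mono_of_nonneg (.of_forall fun H => ?_) (.const_mul ?_ 5)
      (.of_forall fun H => ?_)
    · exact Set.indicator_nonneg (fun _ _ => zero_le_one) H
    · refine .of_bound (measurable_potential.comp hm).aestronglyMeasurable 2 (.of_forall fun H => ?_)
      rw [Real.norm_of_nonneg (potential_nonneg _)]
      exact potential_le_two _
    · exact Set.indicator_apply_le' (fun hH => one_le_five_mul_potential hH)
        fun _ => mul_nonneg (by norm_num) (potential_nonneg _)
  rw [integral_const_mul] at h1
  have h2 := integral_potential_pathRatio_le alg N M T le_rfl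
  unfold fullLaw at *
  linarith

theorem setIntegral_pathRatio_ge_le (alg : Algorithm Act Obs T) (N M : Model Act Obs)
    {u : Act → ℝ} (hu : ∀ π, 0 ≤ u π) :
    ∫ H in {H | pathRatio N M T H < 1 / 2}ᶜ, cumulative alg u T le_rfl H ∂fullLaw alg N ≤
      4 * ∫ H, cumulative alg u T le_rfl H ∂fullLaw alg M := by
  have hm := measurable_pathRatio N M T
  have h0 : ∀ H, 0 ≤ cumulative alg u T le_rfl H := fun H =>
    Finset.sum_nonneg fun _ _ => integral_nonneg hu
  have hc := measurable_cumulative alg u T le_rfl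
  rw [← ENNReal.ofReal_le_ofReal_iff (mul_nonneg (by norm_num) (integral_nonneg h0)),
    ENNReal.ofReal_mul (by norm_num),
    ofReal_integral_eq_lintegral_ofReal (integrable_cumulative alg u T _ _).integrableOn
      (.of_forall h0),
    ofReal_integral_eq_lintegral_ofReal (integrable_cumulative alg u T _ _) (.of_forall h0)]
  refine le_trans ?_ (mul_le_mul' le_rfl (lintegral_mul_pathRatio_sq_le alg N M T le_rfl
    hc.ennreal_ofReal))
  rw [← lintegral_const_mul _ (by fun_prop)]
  refine le_trans ?_ (setLIntegral_le_lintegral {H | pathRatio N M T H < 1 / 2}ᶜ _)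
  refine setLIntegral_mono (by fun_prop) fun H hH => ?_
  have hH : 1 / 2 ≤ pathRatio N M T H := not_lt.1 hH
  rw [← ENNReal.ofReal_mul (h0 H), ← ENNReal.ofReal_mul (by norm_num)]
  refine ENNReal.ofReal_le_ofReal ?_
  have h4 : 1 ≤ 4 * pathRatio N M T H ^ 2 := by nlinarith
  nlinarith [mul_le_mul_of_nonneg_left h4 (h0 H)]

theorem cumulative_add_const_add_mul (alg : Algorithm Act Obs T) (u v : Act → ℝ) (c l : ℝ)
    (H : Fin T → Round Act Obs) :
    cumulative alg (fun π => u π + c + l * v π) T le_rfl H =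
      cumulative alg u T le_rfl H + T * c + l * cumulative alg v T le_rfl H := by
  unfold cumulative
  have : ∀ s : Fin T, ∫ π, (u π + c + l * v π) ∂alg.kernel s (fun i => H (Fin.castLE s.isLt.le i)) =
      ∫ π, u π ∂alg.kernel s (fun i => H (Fin.castLE s.isLt.le i)) + c +
        l * ∫ π, v π ∂alg.kernel s (fun i => H (Fin.castLE s.isLt.le i)) := fun s => by
    rw [integral_add .of_finite .of_finite, integral_add .of_finite .of_finite,
      integral_const_mul]
    simp
  simp only [this, Finset.sum_add_distrib, Finset.mul_sum]
  simp

/-- The histories are split at path ratio `1/2`. Only the constant `c` is charged to the probability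
of the small-ratio event; the costs from `v` and from the Hellinger term are nonnegative and are
enlarged to all histories. -/
theorem integral_cumulative_le (alg : Algorithm Act Obs T) (N M : Model Act Obs) {u v : Act → ℝ}
    (hu : ∀ π, 0 ≤ u π) (hv : ∀ π, 0 ≤ v π) {c l : ℝ} (hc : 0 ≤ c) (hl : 0 ≤ l)
    (huv : ∀ π, u π ≤ v π + c + l * hellingerSq (N.kernel π) (M.kernel π)) :
    ∫ H, cumulative alg u T le_rfl H ∂fullLaw alg N ≤
      4 * ∫ H, cumulative alg u T le_rfl H ∂fullLaw alg M +
        ∫ H, cumulative alg v T le_rfl H ∂fullLaw alg N +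
        (35 / 2 * T * c + l) *
          ∫ H, cumulative alg (fun π => hellingerSq (N.kernel π) (M.kernel π)) T le_rfl H
            ∂fullLaw alg N := by
  have hbad := measureReal_pathRatio_lt_le alg N M
  have hgood := setIntegral_pathRatio_ge_le alg N M hu
  have hA : MeasurableSet {H | pathRatio N M T H < 1 / 2} :=
    measurableSet_lt (measurable_pathRatio N M T) measurable_const
  set A := {H | pathRatio N M T H < 1 / 2}
  set w : Act → ℝ := fun π => hellingerSq (N.kernel π) (M.kernel π)
  have hi : ∀ x, Integrable (cumulative alg x T le_rfl) (fullLaw alg N) := fun x =>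
    integrable_cumulative alg x T le_rfl _
  have h0 : ∀ {x : Act → ℝ}, (∀ π, 0 ≤ x π) → ∀ H, 0 ≤ cumulative alg x T le_rfl H := fun hx H =>
    Finset.sum_nonneg fun _ _ => integral_nonneg hx
  have h1 : ∫ H in A, cumulative alg u T le_rfl H ∂fullLaw alg N ≤
      ∫ H in A, (cumulative alg v T le_rfl H + T * c + l * cumulative alg w T le_rfl H)
        ∂fullLaw alg N := by
    refine integral_mono (hi u).integrableOn
      (((hi v).integrableOn.add (integrable_const _)).add ((hi w).integrableOn.const_mul l))
      fun H => ?_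
    exact (cumulative_mono alg huv T le_rfl H).trans_eq (cumulative_add_const_add_mul alg v w c l H)
  have hvc : Integrable (fun H => cumulative alg v T le_rfl H + T * c)
      ((fullLaw alg N).restrict A) := (hi v).integrableOn.add (integrable_const _)
  rw [integral_add hvc ((hi w).integrableOn.const_mul l),
    integral_add (hi v).integrableOn (integrable_const _), integral_const_mul l] at h1
  simp only [integral_const, measureReal_restrict_apply_univ, smul_eq_mul] at h1
  have h2 : ∫ H in A, cumulative alg v T le_rfl H ∂fullLaw alg N ≤ _ :=
    setIntegral_le_integral (hi v) (.of_forall (h0 hv))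
  have h3 : ∫ H in A, cumulative alg w T le_rfl H ∂fullLaw alg N ≤ _ :=
    setIntegral_le_integral (hi w) (.of_forall (h0 fun π => hellingerSq_nonneg _ _))
  rw [← integral_add_compl hA (hi u)]
  nlinarith [mul_le_mul_of_nonneg_left h3 hl,
    mul_le_mul_of_nonneg_left hbad (mul_nonneg (Nat.cast_nonneg (α := ℝ) T) hc)]

end ChangeOfMeasure

/-! ### Choice of constants and the lower bound on regret -/

section LowerBound

variable {Act Obs : Type*} [MeasurableSpace Act] [MeasurableSpace Obs]

theorem Model.meanReward_nonneg (M : Model Act Obs) (π : Act) : 0 ≤ M.meanReward π :=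
  integral_nonneg fun z => z.1.2.1

theorem Model.meanReward_le_one (M : Model Act Obs) (π : Act) : M.meanReward π ≤ 1 := by
  refine (integral_mono_of_nonneg (.of_forall fun z => z.1.2.1) (integrable_const 1)
    (.of_forall fun z => z.1.2.2)).trans ?_
  simp

theorem Model.meanReward_sub_le (N M : Model Act Obs) (π : Act) {l : ℝ} (hl : 0 < l) :
    N.meanReward π - M.meanReward π ≤ l * hellingerSq (N.kernel π) (M.kernel π) + 1 / l :=
  integral_sub_integral_le (N.kernel π) (M.kernel π)
    (r := fun z : unitInterval × Obs => (z.1 : ℝ)) (by fun_prop) (fun z => z.1.2.1)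
    (fun z => z.1.2.2) hl

theorem constC_ge (S : Set (Model Act Obs)) {T : ℕ} (hT : 2 ≤ T) : 35 ≤ constC S T := by
  have h2 : (2 : ℝ≥0∞) ≤ min (T : ℝ≥0∞) (ratioBound S) := by
    refine le_min (by exact_mod_cast hT) (le_trans ?_ le_sup_right)
    rw [← ENNReal.ofReal_ofNat]
    exact ENNReal.ofReal_le_ofReal (by linarith [Real.add_one_le_exp 1])
  have h3 : (2 : ℝ) ≤ (min (T : ℝ≥0∞) (ratioBound S)).toReal := by
    have := ENNReal.toReal_mono (min_lt_of_left_lt (ENNReal.natCast_lt_top T)).ne h2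
    simpa using this
  have h4 := Real.log_le_log (by norm_num) h3
  have := Real.log_two_gt_d9
  unfold constC
  linarith

variable [Finite Act] [Nonempty Act] {T : ℕ}

theorem integral_regret_nonneg (alg : Algorithm Act Obs T) (M : Model Act Obs) :
    0 ≤ ∫ H, regret alg M H ∂fullLaw alg M :=
  integral_nonneg fun _ => Finset.sum_nonneg fun _ _ => integral_nonneg fun π =>
    sub_nonneg.2 (M.meanReward_le_bestDecision π)

variable [MeasurableSingletonClass Act]

theorem mul_integral_gap_sub_le (S : Set (Model Act Obs)) (hT : 2 ≤ T) (alg : Algorithm Act Obs T)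
    (N M : Model Act Obs) {γ : ℝ} (hγ : 4 * √(constC S T * T) ≤ γ)
    (hM : M ∈ localized S (radius S T γ) N) :
    T * ∫ π, (M.meanReward M.bestDecision - M.meanReward π
        - γ * hellingerSq (M.kernel π) (N.kernel π)) ∂averageDecision alg N ≤
      4 * ∫ H, regret alg M H ∂fullLaw alg M + ∫ H, regret alg N H ∂fullLaw alg N := by
  have hC := constC_ge S hT
  have hT0 : (0 : ℝ) < T := by exact_mod_cast (by omega : 0 < T)
  have hpos : 0 < constC S T * T := by positivity
  have hγ0 : 0 < γ := lt_of_lt_of_le (by positivity) hγ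
  have hsq : 16 * (constC S T * T) ≤ γ ^ 2 := by
    calc _ = (4 * √(constC S T * T)) ^ 2 := by rw [mul_pow, Real.sq_sqrt hpos.le]; norm_num
      _ ≤ _ := pow_le_pow_left₀ (by positivity) hγ 2
  have hε : 0 ≤ radius S T γ := by unfold radius; positivity
  have key := integral_cumulative_le alg N M
    (u := fun π => M.meanReward M.bestDecision - M.meanReward π)
    (v := fun π => N.meanReward N.bestDecision - N.meanReward π)
    (c := radius S T γ + 1 / (γ / 4)) (l := γ / 4)
    (fun π => sub_nonneg.2 (M.meanReward_le_bestDecision π))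
    (fun π => sub_nonneg.2 (N.meanReward_le_bestDecision π)) (by positivity) (by positivity)
    -- The gaps of `M` and `N` differ by the difference of optimal values, at most the radius by
    -- localization, plus `f^N(π) - f^M(π)`, controlled by the Hellinger distance.
    (fun π => by
      have h1 := N.meanReward_sub_le M π (l := γ / 4) (by positivity)
      have h2 := hM.2
      linarith)
  -- Both `T ε_γ = γ / (4C)` and `4T / γ` are at most `γ / 140`, by `C ≥ 35` and `γ² ≥ 16 C T`. The
  -- coefficient is thus at most `γ/4 + γ/4`.
  have hcoef : 35 / 2 * T * (radius S T γ + 1 / (γ / 4)) + γ / 4 ≤ γ := by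
    have h1 : T * radius S T γ ≤ γ / 140 := by
      have : T * radius S T γ = γ / (4 * constC S T) := by unfold radius; field_simp
      rw [this]
      exact div_le_div_of_nonneg_left hγ0.le (by norm_num) (by linarith)
    have h2 : T * (1 / (γ / 4)) ≤ γ / 140 := by
      rw [show T * (1 / (γ / 4)) = 4 * T / γ by field_simp, div_le_iff₀ hγ0]
      nlinarith
    nlinarith
  have hS : 0 ≤ ∫ H, cumulative alg (fun π => hellingerSq (N.kernel π) (M.kernel π)) T le_rfl H
      ∂fullLaw alg N :=
    integral_nonneg fun H => Finset.sum_nonneg fun _ _ =>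
      integral_nonneg fun π => hellingerSq_nonneg _ _
  have hsplit : T * ∫ π, (M.meanReward M.bestDecision - M.meanReward π
        - γ * hellingerSq (M.kernel π) (N.kernel π)) ∂averageDecision alg N =
      ∫ H, cumulative alg (fun π => M.meanReward M.bestDecision - M.meanReward π) T le_rfl H
          ∂fullLaw alg N -
        γ * ∫ H, cumulative alg (fun π => hellingerSq (N.kernel π) (M.kernel π)) T le_rfl H
          ∂fullLaw alg N := by
    have := isProbabilityMeasure_averageDecision (by omega) alg N
    simp_rw [hellingerSq_comm (M.kernel _)]
    rw [integral_sub .of_finite .of_finite, mul_sub, integral_const_mul, mul_left_comm,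
      mul_integral_averageDecision (by omega), mul_integral_averageDecision (by omega)]
  rw [hsplit]
  have := mul_le_mul_of_nonneg_right hcoef hS
  unfold regret
  unfold cumulative at *
  linarith

/-- Rewards lie in `[0, 1]`, so any point mass witnesses this. It serves to exclude the value `⊤`
and so reduce the final comparison to real arithmetic. -/
theorem dec_le_one {γ : ℝ} (hγ : 0 ≤ γ) (S : Set (Model Act Obs)) (N : Model Act Obs) :
    dec γ S N ≤ ((1 : ℝ) : EReal) := by
  refine (iInf_le _ ⟨Measure.dirac (Classical.arbitrary Act), inferInstance⟩).trans
    (iSup₂_le fun M _ => EReal.coe_le_coe_iff.2 ?_)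
  simp only [ProbabilityMeasure.coe_mk, integral_dirac]
  nlinarith [M.meanReward_le_one M.bestDecision, M.meanReward_nonneg (Classical.arbitrary Act),
    mul_nonneg hγ (hellingerSq_nonneg (M.kernel (Classical.arbitrary Act))
      (N.kernel (Classical.arbitrary Act)))]

theorem exists_le_integral_regret (S : Set (Model Act Obs)) (hS : S.Nonempty) (hT : 2 ≤ T)
    (alg : Algorithm Act Obs T) :
    ∃ M ∈ S,
      ((8⁻¹ : ℝ) : EReal) *
          (⨆ γ : ℝ, ⨆ _ : 4 * √(constC S T * T) ≤ γ, ⨆ N ∈ S,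
            dec γ (localized S (radius S T γ) N) N) *
          ((T : ℝ) : EReal) ≤
        ((∫ H, regret alg M H ∂fullLaw alg M : ℝ) : EReal) := by
  have hT0 : (0 : ℝ) < T := by exact_mod_cast (by omega : 0 < T)
  have hub : ∀ b : ℝ, (∀ M ∈ S, ∫ H, regret alg M H ∂fullLaw alg M ≤ b) →
      (⨆ γ : ℝ, ⨆ _ : 4 * √(constC S T * T) ≤ γ, ⨆ N ∈ S,
        dec γ (localized S (radius S T γ) N) N) ≤ ((5 * b / T : ℝ) : EReal) := by
    intro b hb
    refine iSup₂_le fun γ hγ => iSup₂_le fun N hN => ?_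
    refine (iInf_le _ ⟨averageDecision alg N,
      isProbabilityMeasure_averageDecision (by omega) alg N⟩).trans
      (iSup₂_le fun M hM => EReal.coe_le_coe_iff.2 ?_)
    have h1 := mul_integral_gap_sub_le S hT alg N M hγ hM
    rw [le_div_iff₀ hT0]
    simp only [ProbabilityMeasure.coe_mk]
    linarith [hb M hM.1, hb N hN]
  have h1 : (⨆ γ : ℝ, ⨆ _ : 4 * √(constC S T * T) ≤ γ, ⨆ N ∈ S,
      dec γ (localized S (radius S T γ) N) N) ≤ ((1 : ℝ) : EReal) :=
    iSup₂_le fun γ hγ => iSup₂_le fun N _ =>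
      dec_le_one ((by positivity : 0 ≤ 4 * √(constC S T * T)).trans hγ) _ N
  generalize (⨆ γ : ℝ, ⨆ _ : 4 * √(constC S T * T) ≤ γ, ⨆ N ∈ S,
    dec γ (localized S (radius S T γ) N) N) = D at hub h1 ⊢
  induction D with
  | bot =>
    obtain ⟨M, hM⟩ := hS
    refine ⟨M, hM, ?_⟩
    rw [EReal.coe_mul_bot_of_pos (by norm_num), EReal.bot_mul_coe_of_pos hT0]
    exact bot_le
  | top => exact absurd h1 (not_le.2 (EReal.coe_lt_top 1))
  | coe d =>
    simp only [← EReal.coe_mul, EReal.coe_le_coe_iff] at hub ⊢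
    -- If every regret were below `b = d T / 8`, then `d > 0` because regrets are nonnegative, while
    -- `hub` gives `d ≤ 5 d / 8`.
    by_contra! hcon
    obtain ⟨M, hM⟩ := hS
    have hd : 0 < 8⁻¹ * d * T := (integral_regret_nonneg alg M).trans_lt (hcon M hM)
    have h2 := hub (8⁻¹ * d * T) fun M hM => (hcon M hM).le
    rw [le_div_iff₀ hT0] at h2
    linarith

end LowerBound

end DMSO

end

theorem mainTheorem7 {Act Obs : Type*} [Finite Act] [Nonempty Act]
    [MeasurableSpace Act] [MeasurableSingletonClass Act] [MeasurableSpace Obs]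
    (S : Set (DMSO.Model Act Obs)) (hS : S.Nonempty) (T : ℕ) (hT : 2 ≤ T)
    (alg : DMSO.Algorithm Act Obs T) :
    ∃ M ∈ S,
      ((8⁻¹ : ℝ) : EReal) *
          (⨆ γ : ℝ, ⨆ _ : 4 * √(DMSO.constC S T * T) ≤ γ, ⨆ Mbar ∈ S,
            DMSO.dec γ (DMSO.localized S (DMSO.radius S T γ) Mbar) Mbar) *
          ((T : ℝ) : EReal) ≤
        (((∫ H, DMSO.regret alg M H ∂(DMSO.fullLaw alg M)) +
          √(DMSO.oneSidedVariance (DMSO.fullLaw alg M) (DMSO.regret alg M)) : ℝ) : EReal) := by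
  obtain ⟨M, hM, h⟩ := DMSO.exists_le_integral_regret S hS hT alg
  exact ⟨M, hM, h.trans (EReal.coe_le_coe_iff.2 (le_add_of_nonneg_right (Real.sqrt_nonneg _)))⟩
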